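/- Let $d,t\ge 1$, let $\mathcal H_X=\mathbb C^d$ and $\mathcal H_R=\mathbb C^{d_R}$, and let $\mathcal U(d)$ be the unitary group of $\mathcal H_X$ with its normalized Haar measure. A unit vector $\psi\in\mathcal H_X\otimes\mathcal H_R$ has Schmidt rank $r$ if $\psi=\sum_{k=1}^{r}\sqrt{c_k}\,\xi_k\otimes\zeta_k$ with $c_k>0$, $\sum_k c_k=1$, and orthonormal families $(\xi_k)$ in $\mathcal H_X$ and $(\zeta_k)$ in $\mathcal H_R$. For a target $U\in\mathcal U(d)$ and a tuple of training inputs $\psi=(\psi_1,\dots,\psi_t)$ of unit vectors in $\mathcal H_X\otimes\mathcal H_R$, the training set is $S=S(U,\psi)=\big((\psi_j,\phi_j)\big)_{j=1}^t$ with $\phi_j=(U\otimes I)\psi_j$. A training procedure is a measurable map $S\mapsto V_S\in\mathcal U(d)$ from $t$-tuples of pairs of unit vectors to hypothesis unitaries, so that $V_S$ depends on $U$ only through $S$. Its loss on $S$ is $$L(V_S)=1-\frac1t\sum_{j=1}^t\big|\langle \phi_j,(V_S\otimes I)\psi_j\rangle\big|^2 .$$ The risk of $V\in\mathcal U(d)$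 with respect to $U$ is $$R_U(V)=\int D\big(U|x\rangle\langle x|U^\dagger,\;V|x\rangle\langle x|V^\dagger\big)^2\,dx,$$ where $D(\rho,\sigma)=\tfrac12\operatorname{Tr}|\rho-\sigma|$ with $|A|=\sqrt{A^\dagger A}$ is the trace distance and $x$ is uniformly distributed on the unit sphere of $\mathcal H_X$. Let the training inputs $\psi$ be distributed, independently of $U$, according to an arbitrary probability measure $\nu$ on $t$-tuples of unit vectors in $\mathcal H_X\otimes\mathcal H_R$ such that, almost surely, the Schmidt ranks $r_1,\dots,r_t\ge1$ of $\psi_1,\dots,\psi_t$ (possibly different, and possibly random) have the fixed average $\bar r=\frac1t\sum_{j=1}^t r_j$. Assume perfect training: for almost every $U$ and $\nu$-almost every $\psi$, the loss $L(V_S)$ is $0$. Then $$\mathbb E_U\big[\mathbb E_S[R_U(V_S)]\big]=\int_{\mathcal U(d)}\int R_U\big(V_{S(U,\psi)}\big)\,d\nu(\psi)\,dU\;\ge\;1-\frac{(\bar r\,t)^2+d+1}{d(d+1)} .$$ -/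

import Mathlib

open MeasureTheory
open scoped MatrixOrder Kronecker

namespace QNFL

/-- Normalized pure states of the Hilbert space `ℂ^ι` (with its Euclidean inner product). -/
abbrev PureState (ι : Type) [Fintype ι] : Type :=
  Metric.sphere (0 : EuclideanSpace ℂ ι) 1

/-- The unitary group `𝒰(ι)` of the Hilbert space `ℂ^ι`. -/
abbrev Unitaries (ι : Type) [Fintype ι] [DecidableEq ι] : Type :=
  Matrix.unitaryGroup ι ℂ

section Haar

variable {ι : Type} [Fintype ι] [DecidableEq ι]

noncomputable instance instMeasurableSpaceUnitaries : MeasurableSpace (Unitaries ι) := borel _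

instance instBorelSpaceUnitaries : BorelSpace (Unitaries ι) := ⟨rfl⟩

theorem isCompact_unitaryGroup : IsCompact (Matrix.unitaryGroup ι ℂ : Set (Matrix ι ι ℂ)) := by
  have hK : IsCompact (Set.pi Set.univ fun _ : ι => Set.pi Set.univ fun _ : ι =>
      Metric.closedBall (0 : ℂ) 1) :=
    isCompact_univ_pi fun _ => isCompact_univ_pi fun _ => isCompact_closedBall _ _
  refine IsCompact.of_isClosed_subset (s := (Set.pi Set.univ fun _ : ι => Set.pi Set.univ
    fun _ : ι => Metric.closedBall (0 : ℂ) 1 : Set (Matrix ι ι ℂ))) hK ?_ ?_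
  · have h : (Matrix.unitaryGroup ι ℂ : Set (Matrix ι ι ℂ)) = {A | A * star A = 1} := by
      ext A
      exact Matrix.mem_unitaryGroup_iff
    rw [h]
    exact isClosed_eq (by fun_prop) continuous_const
  · intro A hA i _ j _
    rw [mem_closedBall_zero_iff]
    exact entry_norm_bound_of_unitary hA i j

instance instCompactSpaceUnitaries : CompactSpace (Unitaries ι) :=
  isCompact_iff_compactSpace.mp isCompact_unitaryGroup

/-- The normalized Haar measure on the (compact) unitary group. -/
noncomputable def haarUnitary (ι : Type) [Fintype ι] [DecidableEq ι] : Measure (Unitaries ι) :=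
  Measure.haarMeasure ⊤

end Haar

section Evolution

variable {ι : Type} [Fintype ι] [DecidableEq ι]

/-- The state `W|x⟩`. -/
noncomputable def evolve (W : Unitaries ι) (x : PureState ι) : PureState ι :=
  ⟨Matrix.toEuclideanLin (W : Matrix ι ι ℂ) x, by
    have h : ‖Matrix.toEuclideanLin (W : Matrix ι ι ℂ) (x : EuclideanSpace ℂ ι)‖ ^ 2 =
        ‖(x : EuclideanSpace ℂ ι)‖ ^ 2 := by
      have hW : (W : Matrix ι ι ℂ).conjTranspose * (W : Matrix ι ι ℂ) = 1 :=
        Matrix.mem_unitaryGroup_iff'.mp W.2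
      have h1 : inner ℂ (Matrix.toEuclideanLin (W : Matrix ι ι ℂ) (x : EuclideanSpace ℂ ι))
          (Matrix.toEuclideanLin (W : Matrix ι ι ℂ) (x : EuclideanSpace ℂ ι)) =
          inner ℂ (x : EuclideanSpace ℂ ι) (x : EuclideanSpace ℂ ι) := by
        rw [← LinearMap.adjoint_inner_right, ← Matrix.toEuclideanLin_conjTranspose_eq_adjoint]
        congr 1
        ext1
        simp [Matrix.toLpLin_apply, Matrix.mulVec_mulVec, hW]
      rw [inner_self_eq_norm_sq_to_K, inner_self_eq_norm_sq_to_K] at h1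
      exact_mod_cast h1
    rw [mem_sphere_zero_iff_norm]
    have hx : ‖(x : EuclideanSpace ℂ ι)‖ = 1 := mem_sphere_zero_iff_norm.mp x.2
    rw [hx] at h
    exact (pow_left_inj₀ (norm_nonneg _) zero_le_one two_ne_zero).mp (by simpa using h)⟩

/-- The operator `W ⊗ I` on `H_X ⊗ H_R = ℂ^(ι × κ)`. -/
noncomputable def tensorId (κ : Type) [Fintype κ] [DecidableEq κ] (W : Unitaries ι) :
    Unitaries (ι × κ) :=
  ⟨(W : Matrix ι ι ℂ) ⊗ₖ (1 : Matrix κ κ ℂ), Matrix.kronecker_mem_unitary W.2 (one_mem _)⟩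

end Evolution

section Risk

variable {ι : Type} [Fintype ι] [DecidableEq ι]

/-- The density matrix `|y⟩⟨y|`. -/
def density (y : PureState ι) : Matrix ι ι ℂ :=
  Matrix.of fun i j => (y : EuclideanSpace ℂ ι) i * star ((y : EuclideanSpace ℂ ι) j)

/-- The trace distance `D(ρ, σ) = ½ Tr |ρ - σ|`, where `|A| = √(A† A)`. -/
noncomputable def traceDist (ρ σ : Matrix ι ι ℂ) : ℝ :=
  (1 / 2) * (Matrix.trace (CFC.abs (ρ - σ))).re

/-- The risk `R_U(V)`: the average over uniformly distributed pure states `|x⟩` (normalized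
surface measure of the unit sphere) of the squared trace distance between the outputs
`U|x⟩` and `V|x⟩`. -/
noncomputable def risk (U V : Unitaries ι) : ℝ :=
  ⨍ x : PureState ι, traceDist (density (evolve U x)) (density (evolve V x)) ^ 2
    ∂((volume : Measure (EuclideanSpace ℂ ι)).toSphere)

end Risk

/-- `ψ ∈ H_X ⊗ H_R` has Schmidt rank `r`: it has a Schmidt decomposition
`ψ = ∑_{k < r} √c_k ξ_k ⊗ ζ_k` with exactly `r` terms, i.e. with orthonormal `ξ_k ∈ H_X`,
orthonormal `ζ_k ∈ H_R` and coefficients `c_k > 0`, `∑ c_k = 1`. -/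
def HasSchmidtRank {ι κ : Type} [Fintype ι] [Fintype κ]
    (ψ : PureState (ι × κ)) (r : ℕ) : Prop :=
  ∃ (c : Fin r → ℝ) (ξ : Fin r → EuclideanSpace ℂ ι) (ζ : Fin r → EuclideanSpace ℂ κ),
    (∀ k, 0 < c k) ∧ ∑ k, c k = 1 ∧ Orthonormal ℂ ξ ∧ Orthonormal ℂ ζ ∧
    ∀ i a, (ψ : EuclideanSpace ℂ (ι × κ)) (i, a) = ∑ k, (Real.sqrt (c k) : ℂ) * (ξ k i * ζ k a)

section Training

variable {ι κ : Type} [Fintype ι] [DecidableEq ι] [Fintype κ] [DecidableEq κ] {t : ℕ}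

/-- A training set of size `t`: pairs of an input state and an output state in `H_X ⊗ H_R`. -/
abbrev TrainingSet (ι κ : Type) [Fintype ι] [Fintype κ] (t : ℕ) : Type :=
  Fin t → PureState (ι × κ) × PureState (ι × κ)

/-- The training set `{(ψ_j, (U ⊗ I) ψ_j)}` of target `U` and inputs `ψ_1, …, ψ_t`. -/
noncomputable def trainingSet (U : Unitaries ι) (ψ : Fin t → PureState (ι × κ)) :
    TrainingSet ι κ t :=
  fun j => (ψ j, evolve (tensorId κ U) (ψ j))

/-- The loss `1 - (1/t) ∑_j |⟨φ_j | (V ⊗ I) ψ_j⟩|²` of `V` on the samples `(ψ_j, φ_j)` of `S`. -/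
noncomputable def loss (S : TrainingSet ι κ t) (V : Unitaries ι) : ℝ :=
  1 - (1 / (t : ℝ)) * ∑ j, ‖(inner ℂ ((S j).2 : EuclideanSpace ℂ (ι × κ))
    (evolve (tensorId κ V) (S j).1 : EuclideanSpace ℂ (ι × κ)) : ℂ)‖ ^ 2

end Training

end QNFL

/-! The training set sees only part of the target. If a unitary Y fixes every Schmidt vector of
every input on the first factor, then U and UY produce the same training set, hence the same
hypothesis V. Haar measure is invariant under U ↦ UY, so the expected risk is unchanged when the
risk at U is replaced by its average over any finite family of such Y.

The risk depends on the overlap of target and hypothesis alone: for pure states the squared trace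
distance is 1 − |⟨y,z⟩|² (`traceDist_density_sq`), and the fourth moments of the uniform
distribution on the sphere (`moment_eq`) give R_U(V) = 1 − (|tr U†V|² + d)/(d(d+1)) (`risk_eq`). It
remains to bound the average of |tr Y†W|² for W = U†V.

Let K be the span of the Schmidt vectors, so dim K ≤ ∑ r_j = r̄t. Each Y is the identity on K and a
signed cyclic shift on the orthogonal complement. The K-block of W contributes at most (dim K)² to
the average; the signs and shifts make the other block contribute at most 1, with no cross term
(`exists_unitaries_fixing_submodule`). This yields the bound for each fixed tuple of inputs
(`le_integral_risk`), and Fubini integrates it over the inputs. -/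

namespace QNFL

set_option linter.unusedSectionVars false

/-! ### Trace distance of pure states -/

section TraceDistance

variable {ι : Type} [Fintype ι] [DecidableEq ι]

theorem sum_mul_star_self (y : PureState ι) :
    ∑ i, (y : EuclideanSpace ℂ ι) i * star ((y : EuclideanSpace ℂ ι) i) = 1 := by
  have h : ‖(y : EuclideanSpace ℂ ι)‖ = 1 := mem_sphere_zero_iff_norm.mp y.2
  have h2 := EuclideanSpace.norm_sq_eq (y : EuclideanSpace ℂ ι)
  rw [h] at h2
  simp only [Complex.star_def, Complex.mul_conj, Complex.normSq_eq_norm_sq]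
  exact_mod_cast (by simpa using h2.symm)

theorem inner_eq_sum (y z : PureState ι) :
    inner ℂ (y : EuclideanSpace ℂ ι) (z : EuclideanSpace ℂ ι) =
      ∑ i, star ((y : EuclideanSpace ℂ ι) i) * (z : EuclideanSpace ℂ ι) i := by
  simp [PiLp.inner_apply, mul_comm]

theorem density_mul_apply (y z : PureState ι) (i j : ι) :
    (density y * density z) i j = inner ℂ (y : EuclideanSpace ℂ ι) (z : EuclideanSpace ℂ ι) *
      ((y : EuclideanSpace ℂ ι) i * star ((z : EuclideanSpace ℂ ι) j)) := by
  simp only [Matrix.mul_apply, density, Matrix.of_apply, inner_eq_sum, Finset.sum_mul]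
  exact Finset.sum_congr rfl fun k _ => by ring

theorem density_mul_self (y : PureState ι) : density y * density y = density y := by
  ext i j
  rw [density_mul_apply, inner_eq_sum]
  simp only [mul_comm (star _)]
  rw [sum_mul_star_self]
  simp [density]

theorem density_mul_density_mul_density (y z : PureState ι) :
    density y * density z * density y =
      ((‖(inner ℂ (y : EuclideanSpace ℂ ι) (z : EuclideanSpace ℂ ι) : ℂ)‖ ^ 2 : ℝ) : ℂ) •
        density y := by
  ext i j
  rw [Matrix.mul_apply]
  simp only [density_mul_apply]
  have h := inner_conj_symm (𝕜 := ℂ) (y : EuclideanSpace ℂ ι) (z : EuclideanSpace ℂ ι)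
  have h2 := Complex.mul_conj (inner ℂ (y : EuclideanSpace ℂ ι) (z : EuclideanSpace ℂ ι))
  rw [← Complex.normSq_eq_norm_sq, ← h2, ← Complex.star_def, inner_eq_sum, Matrix.smul_apply,
    smul_eq_mul, star_sum, Finset.mul_sum, Finset.sum_mul]
  exact Finset.sum_congr rfl fun k _ => by simp [density]; ring

theorem trace_density (y : PureState ι) : (density y).trace = 1 := by
  rw [← sum_mul_star_self y]; rfl

theorem trace_density_mul (y z : PureState ι) :
    (density y * density z).trace =
      ((‖(inner ℂ (y : EuclideanSpace ℂ ι) (z : EuclideanSpace ℂ ι) : ℂ)‖ ^ 2 : ℝ) : ℂ) := by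
  have h2 := Complex.mul_conj (inner ℂ (y : EuclideanSpace ℂ ι) (z : EuclideanSpace ℂ ι))
  rw [← Complex.normSq_eq_norm_sq, ← h2, ← Complex.star_def, Matrix.trace]
  simp only [Matrix.diag_apply, density_mul_apply]
  rw [← Finset.mul_sum, inner_eq_sum, star_sum]
  congr 1
  exact Finset.sum_congr rfl fun k _ => by simp [mul_comm]

theorem isHermitian_density (y : PureState ι) : (density y).IsHermitian := by
  ext i j
  simp [density, mul_comm]

theorem norm_inner_sq_le_one (y z : PureState ι) :
    ‖(inner ℂ (y : EuclideanSpace ℂ ι) (z : EuclideanSpace ℂ ι) : ℂ)‖ ^ 2 ≤ 1 := by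
  have h := norm_inner_le_norm (𝕜 := ℂ) (y : EuclideanSpace ℂ ι) (z : EuclideanSpace ℂ ι)
  rw [mem_sphere_zero_iff_norm.mp y.2, mem_sphere_zero_iff_norm.mp z.2, mul_one] at h
  exact pow_le_one₀ (norm_nonneg _) h

open scoped ComplexOrder in
/-- A Hermitian matrix `A` with `A ^ 3 = s ^ 2 A` has absolute value `A ^ 2 / s`. -/
theorem abs_eq_of_cube_eq {A : Matrix ι ι ℂ} (hA : A.IsHermitian) {s : ℝ} (hs : 0 < s)
    (h : A * A * A = ((s ^ 2 : ℝ) : ℂ) • A) : CFC.abs A = ((s⁻¹ : ℝ) : ℂ) • (A * A) := by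
  have hA' : star A = A := hA
  refine CFC.sqrt_unique ?_ ?_
  · rw [Matrix.smul_mul, Matrix.mul_smul, smul_smul, ← Matrix.mul_assoc, h, Matrix.smul_mul,
      smul_smul, hA']
    have : ((s⁻¹ : ℝ) : ℂ) * ((s⁻¹ : ℝ) : ℂ) * ((s ^ 2 : ℝ) : ℂ) = 1 := by
      norm_cast
      field_simp
    rw [this, one_smul]
  · have h1 : 0 ≤ A * A := by
      have := star_mul_self_nonneg A
      rwa [hA'] at this
    exact smul_nonneg (by exact_mod_cast (inv_pos.mpr hs).le) h1

open scoped ComplexOrder in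
-- The difference A of the two projections is traceless, Hermitian and of rank at most 2, with
-- eigenvalues ±√(1 − c) for c = |⟨y,z⟩|². This is encoded as A³ = (1 − c)A, so |A| = A²/√(1 − c),
-- whose trace is 2√(1 − c).
theorem traceDist_density_sq (y z : PureState ι) :
    traceDist (density y) (density z) ^ 2 =
      1 - ‖(inner ℂ (y : EuclideanSpace ℂ ι) (z : EuclideanSpace ℂ ι) : ℂ)‖ ^ 2 := by
  set c : ℝ := ‖(inner ℂ (y : EuclideanSpace ℂ ι) (z : EuclideanSpace ℂ ι) : ℂ)‖ ^ 2 with hc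
  have hc' : ‖(inner ℂ (z : EuclideanSpace ℂ ι) (y : EuclideanSpace ℂ ι) : ℂ)‖ ^ 2 = c := by
    rw [hc, norm_inner_symm]
  have hc1 : c ≤ 1 := norm_inner_sq_le_one y z
  set A := density y - density z with hA
  have hherm : A.IsHermitian := (isHermitian_density y).sub (isHermitian_density z)
  have hsq : A * A = density y + density z - density y * density z - density z * density y := by
    rw [hA, Matrix.sub_mul, Matrix.mul_sub, Matrix.mul_sub, density_mul_self, density_mul_self]
    abel
  have htr : (A * A).trace = ((2 * (1 - c) : ℝ) : ℂ) := by
    rw [hsq, Matrix.trace_sub, Matrix.trace_sub, Matrix.trace_add, trace_density, trace_density,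
      trace_density_mul, trace_density_mul, hc', ← hc]
    push_cast
    ring
  have hyzy := density_mul_density_mul_density y z
  have hzyz := density_mul_density_mul_density z y
  rw [hc'] at hzyz
  rw [← hc] at hyzy
  have hcube : A * A * A = (((1 - c : ℝ)) : ℂ) • A := by
    have h1 : density y * density z * density z = density y * density z := by
      rw [Matrix.mul_assoc, density_mul_self]
    have h2 : density z * density y * density y = density z * density y := by
      rw [Matrix.mul_assoc, density_mul_self]
    rw [hsq, hA]
    simp only [Matrix.sub_mul, Matrix.add_mul, Matrix.mul_sub, density_mul_self, h1, h2, hyzy, hzyz]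
    push_cast
    module
  rcases hc1.lt_or_eq with hlt | heq
  · have hpos : 0 < 1 - c := by linarith
    have hs := Real.sqrt_pos.mpr hpos
    rw [← Real.sq_sqrt hpos.le] at hcube
    unfold traceDist
    rw [abs_eq_of_cube_eq hherm hs hcube, Matrix.trace_smul, htr, smul_eq_mul, ← Complex.ofReal_mul,
      Complex.ofReal_re]
    have h3 : (√(1 - c))⁻¹ * (2 * (1 - c)) = 2 * √(1 - c) := by
      nth_rewrite 2 [← Real.sq_sqrt hpos.le]
      field_simp
    rw [h3]
    have := Real.sq_sqrt hpos.le
    linarith [this]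
  -- When c = 1 the division by √(1 − c) is unavailable, but tr A†A = 2(1 − c) = 0 forces A = 0.
  · have hA0 : A = 0 := by
      have : (A.conjTranspose * A).trace = 0 := by rw [hherm.eq, htr, heq]; simp
      exact Matrix.trace_conjTranspose_mul_self_eq_zero_iff.mp this
    unfold traceDist
    rw [← hA, hA0, heq]
    simp

end TraceDistance

/-! ### Fourth moments of a unitarily invariant measure on the sphere -/

section Moments

variable {ι : Type} [Fintype ι] [DecidableEq ι]

theorem evolve_apply (W : Unitaries ι) (x : PureState ι) (i : ι) :
    (evolve W x : EuclideanSpace ℂ ι) i =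
      ∑ j, (W : Matrix ι ι ℂ) i j * (x : EuclideanSpace ℂ ι) j := by
  simp [evolve, Matrix.toLpLin_apply, Matrix.mulVec, dotProduct]

theorem continuous_coord (i : ι) :
    Continuous fun x : PureState ι => (x : EuclideanSpace ℂ ι) i :=
  (EuclideanSpace.proj (𝕜 := ℂ) i).continuous.comp continuous_subtype_val

/-- The unitary that multiplies the coordinate `a` by the phase `z`. -/
noncomputable def phaseAt (a : ι) (z : ℂ) (hz : z * star z = 1) : Unitaries ι :=
  ⟨Matrix.diagonal (Function.update 1 a z), by
    rw [Matrix.mem_unitaryGroup_iff, Matrix.star_eq_conjTranspose, Matrix.diagonal_conjTranspose,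
      Matrix.diagonal_mul_diagonal, ← Matrix.diagonal_one]
    congr 1
    ext i
    by_cases h : i = a
    · subst h; simpa using hz
    · simp [Function.update_of_ne h]⟩

theorem evolve_phaseAt_apply (a : ι) (z : ℂ) (hz : z * star z = 1) (x : PureState ι) (i : ι) :
    (evolve (phaseAt a z hz) x : EuclideanSpace ℂ ι) i =
      (if i = a then z else 1) * (x : EuclideanSpace ℂ ι) i := by
  simp [evolve_apply, phaseAt, Matrix.diagonal_apply, Function.update_apply]

/-- The reflection in the hyperplane orthogonal to `e_i + 2 e_j`. -/
noncomputable def planeReflection (i j : ι) (hij : i ≠ j) : Unitaries ι :=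
  ⟨1 - (2 / 5 : ℂ) • Matrix.vecMulVec (Pi.single i 1 + Pi.single j 2)
      (Pi.single i 1 + Pi.single j 2), by
    have hstar : star (Matrix.vecMulVec (Pi.single i 1 + Pi.single j 2 : ι → ℂ)
        (Pi.single i 1 + Pi.single j 2)) = Matrix.vecMulVec (Pi.single i 1 + Pi.single j 2)
        (Pi.single i 1 + Pi.single j 2) := by
      ext a b
      simp [Matrix.vecMulVec_apply, Pi.single_apply, apply_ite (starRingEnd ℂ), mul_comm,
        show (starRingEnd ℂ) 2 = 2 from Complex.conj_ofNat 2]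
    have hmul : Matrix.vecMulVec (Pi.single i 1 + Pi.single j 2 : ι → ℂ)
        (Pi.single i 1 + Pi.single j 2) * Matrix.vecMulVec (Pi.single i 1 + Pi.single j 2)
        (Pi.single i 1 + Pi.single j 2) = (5 : ℂ) • Matrix.vecMulVec (Pi.single i 1 + Pi.single j 2)
        (Pi.single i 1 + Pi.single j 2) := by
      have h5 : (Pi.single i 1 + Pi.single j 2 : ι → ℂ) ⬝ᵥ (Pi.single i 1 + Pi.single j 2) = 5 := by
        simp [hij, hij.symm]
        norm_num
      rw [Matrix.vecMulVec_mul_vecMulVec, h5, Matrix.vecMulVec_smul]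
    rw [Matrix.mem_unitaryGroup_iff]
    simp only [star_sub, star_one, star_smul, hstar, mul_sub, sub_mul, Matrix.mul_smul,
      Matrix.smul_mul, hmul, one_mul, mul_one, show star (2 / 5 : ℂ) = 2 / 5 by simp]
    module⟩

theorem evolve_planeReflection_left (i j : ι) (hij : i ≠ j) (x : PureState ι) :
    (evolve (planeReflection i j hij) x : EuclideanSpace ℂ ι) i =
      3 / 5 * (x : EuclideanSpace ℂ ι) i - 4 / 5 * (x : EuclideanSpace ℂ ι) j := by
  simp [evolve_apply, planeReflection, Matrix.sub_apply, Matrix.vecMulVec_apply, Matrix.one_apply,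
    sub_mul, Finset.sum_sub_distrib, hij, Pi.single_apply, mul_add, add_mul,
    Finset.sum_add_distrib]
  ring

theorem evolve_planeReflection_right (i j : ι) (hij : i ≠ j) (x : PureState ι) :
    (evolve (planeReflection i j hij) x : EuclideanSpace ℂ ι) j =
      -(3 / 5) * (x : EuclideanSpace ℂ ι) j - 4 / 5 * (x : EuclideanSpace ℂ ι) i := by
  simp [evolve_apply, planeReflection, Matrix.sub_apply, Matrix.vecMulVec_apply, Matrix.one_apply,
    sub_mul, Finset.sum_sub_distrib, hij.symm, Pi.single_apply, mul_add, add_mul,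
    Finset.sum_add_distrib]
  ring

variable (P : Measure (PureState ι))

/-- The fourth moment `E[x_i x_j conj(x_k) conj(x_l)]`. -/
noncomputable def moment (i j k l : ι) : ℂ :=
  ∫ x : PureState ι, (x : EuclideanSpace ℂ ι) i * (x : EuclideanSpace ℂ ι) j *
    star ((x : EuclideanSpace ℂ ι) k) * star ((x : EuclideanSpace ℂ ι) l) ∂P

theorem moment_comm_left (i j k l : ι) : moment P i j k l = moment P j i k l := by
  simp only [moment, mul_comm ((_ : EuclideanSpace ℂ ι) i)]

theorem moment_comm_right (i j k l : ι) : moment P i j k l = moment P i j l k := by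
  simp only [moment, mul_right_comm]

theorem integrable_of_continuous [IsFiniteMeasure P] {E : Type*} [NormedAddCommGroup E]
    {f : PureState ι → E} (hf : Continuous f) [SecondCountableTopology E] : Integrable f P := by
  obtain ⟨C, hC⟩ := (isCompact_range hf).isBounded.exists_norm_le
  borelize E
  exact Integrable.of_bound hf.aestronglyMeasurable C (.of_forall fun x => hC _ ⟨x, rfl⟩)

theorem continuous_moment (i j k l : ι) :
    Continuous fun x : PureState ι => (x : EuclideanSpace ℂ ι) i * (x : EuclideanSpace ℂ ι) j *
      star ((x : EuclideanSpace ℂ ι) k) * star ((x : EuclideanSpace ℂ ι) l) :=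
  (((continuous_coord i).mul (continuous_coord j)).mul (continuous_coord k).star).mul
      (continuous_coord l).star

theorem integrable_moment [IsFiniteMeasure P] (i j k l : ι) :
    Integrable (fun x : PureState ι => (x : EuclideanSpace ℂ ι) i * (x : EuclideanSpace ℂ ι) j *
      star ((x : EuclideanSpace ℂ ι) k) * star ((x : EuclideanSpace ℂ ι) l)) P :=
  integrable_of_continuous P (continuous_moment i j k l)

variable {P}


theorem integral_comp_evolve (hP : ∀ W : Unitaries ι, MeasurePreserving (evolve W) P P) (W : Unitaries ι) (f : PureState ι → ℂ) (hf : Continuous f) :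
    ∫ x, f (evolve W x) ∂P = ∫ x, f x ∂P := by
  rw [← integral_map (φ := evolve W) (hP W).measurable.aemeasurable
    hf.aestronglyMeasurable, (hP W).map_eq]

/-- A phase on the coordinate a multiplies the integrand by z to the number of occurrences of a
among i, j minus that among k, l. A moment with nonzero net exponent then vanishes, for a suitable
z. -/
theorem moment_phase (hP : ∀ W : Unitaries ι, MeasurePreserving (evolve W) P P) (a : ι) (z : ℂ) (hz : z * star z = 1) (i j k l : ι) :
    moment P i j k l = (if i = a then z else 1) * (if j = a then z else 1) *
      star (if k = a then z else 1) * star (if l = a then z else 1) * moment P i j k l := by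
  have h := integral_comp_evolve hP (phaseAt a z hz) _ (continuous_moment i j k l)
  rw [moment, ← integral_const_mul]
  refine h.symm.trans ?_
  refine integral_congr_ae (.of_forall fun x => ?_)
  simp only [evolve_phaseAt_apply, star_mul']
  ring

theorem moment_eq_zero (hP : ∀ W : Unitaries ι, MeasurePreserving (evolve W) P P) {i j k l : ι}
    (h1 : ¬(i = k ∧ j = l)) (h2 : ¬(i = l ∧ j = k)) : moment P i j k l = 0 := by
  -- The phase −1 detects an odd net exponent. The phase `Complex.I` is needed for i = j with i
  -- absent from k, l, where the net exponent is 2.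
  have hneg := fun a => moment_phase hP a (-1) (by simp) i j k l
  have hI := fun a => moment_phase hP a Complex.I (by simp) i j k l
  by_cases hik : i = k
  · have hjl : j ≠ l := fun h => h1 ⟨hik, h⟩
    have h := hneg j
    subst hik
    by_cases hij : i = j <;> simp [hij, hjl.symm] at h ⊢ <;> grind
  · by_cases hil : i = l
    · have hjk : j ≠ k := fun h => h2 ⟨hil, h⟩
      have h := hneg j
      subst hil
      by_cases hij : i = j <;> simp [hij, hjk.symm] at h ⊢ <;> grind
    · have h := hI i
      have h' := hneg i
      by_cases hij : j = i
      · simp [hij, Ne.symm hik, Ne.symm hil] at h ⊢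
        grind
      · simp [hij, Ne.symm hik, Ne.symm hil] at h' ⊢
        grind

theorem integral_plane_quartic [IsFiniteMeasure P]
    (hP : ∀ W : Unitaries ι, MeasurePreserving (evolve W) P P) {i j : ι}
    (hij : i ≠ j) (c s : ℝ) :
    ∫ x : PureState ι, ((c * (x : EuclideanSpace ℂ ι) i + s * (x : EuclideanSpace ℂ ι) j) *
      (c * (x : EuclideanSpace ℂ ι) i + s * (x : EuclideanSpace ℂ ι) j) *
      star (c * (x : EuclideanSpace ℂ ι) i + s * (x : EuclideanSpace ℂ ι) j) *
      star (c * (x : EuclideanSpace ℂ ι) i + s * (x : EuclideanSpace ℂ ι) j)) ∂P =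
    c ^ 4 * moment P i i i i + 4 * c ^ 2 * s ^ 2 * moment P i j i j + s ^ 4 * moment P j j j j := by
  have I := fun a b c d => integrable_moment P (ι := ι) a b c d
  have expand : ∀ x : PureState ι,
      -- The 16 monomials are indexed by four Booleans, `true` choosing the coordinate i. Ten of
      -- them integrate to zero, and the four mixed survivors all equal `moment P i j i j`.
      ((c * (x : EuclideanSpace ℂ ι) i + s * (x : EuclideanSpace ℂ ι) j) *
      (c * (x : EuclideanSpace ℂ ι) i + s * (x : EuclideanSpace ℂ ι) j) *
      star (c * (x : EuclideanSpace ℂ ι) i + s * (x : EuclideanSpace ℂ ι) j) *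
      star (c * (x : EuclideanSpace ℂ ι) i + s * (x : EuclideanSpace ℂ ι) j)) =
      ∑ p : Bool × Bool × Bool × Bool,
        (bif p.1 then (c : ℂ) else s) * (bif p.2.1 then (c : ℂ) else s) *
        (bif p.2.2.1 then (c : ℂ) else s) * (bif p.2.2.2 then (c : ℂ) else s) *
        ((x : EuclideanSpace ℂ ι) (bif p.1 then i else j) *
          (x : EuclideanSpace ℂ ι) (bif p.2.1 then i else j) *
          star ((x : EuclideanSpace ℂ ι) (bif p.2.2.1 then i else j)) *
          star ((x : EuclideanSpace ℂ ι) (bif p.2.2.2 then i else j))) := by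
    intro x
    simp [Fintype.sum_prod_type]
    ring
  simp only [expand]
  rw [integral_finsetSum _ fun p _ => (I (bif p.1 then i else j) (bif p.2.1 then i else j)
    (bif p.2.2.1 then i else j) (bif p.2.2.2 then i else j)).const_mul _]
  simp only [integral_const_mul]
  have e : ∀ a b c d : ι, ∫ x : PureState ι, ((x : EuclideanSpace ℂ ι) a *
    (x : EuclideanSpace ℂ ι) b * star ((x : EuclideanSpace ℂ ι) c) *
      star ((x : EuclideanSpace ℂ ι) d)) ∂P = moment P a b c d := fun _ _ _ _ => rfl
  simp only [e, Fintype.sum_prod_type, Fintype.sum_bool, cond_true, cond_false]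
  have hji := hij.symm
  rw [moment_eq_zero hP (i := i) (j := i) (k := i) (l := j) (by simp [hij]) (by simp [hij]),
    moment_eq_zero hP (i := i) (j := i) (k := j) (l := i) (by simp [hij]) (by simp [hij]),
    moment_eq_zero hP (i := i) (j := i) (k := j) (l := j) (by simp [hij]) (by simp [hij]),
    moment_eq_zero hP (i := i) (j := j) (k := i) (l := i) (by simp [hji]) (by simp [hji]),
    moment_eq_zero hP (i := i) (j := j) (k := j) (l := j) (by simp [hij]) (by simp [hij]),
    moment_eq_zero hP (i := j) (j := i) (k := i) (l := i) (by simp [hji]) (by simp [hji]),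
    moment_eq_zero hP (i := j) (j := i) (k := j) (l := j) (by simp [hij]) (by simp [hij]),
    moment_eq_zero hP (i := j) (j := j) (k := i) (l := i) (by simp [hji]) (by simp [hji]),
    moment_eq_zero hP (i := j) (j := j) (k := i) (l := j) (by simp [hji]) (by simp [hji]),
    moment_eq_zero hP (i := j) (j := j) (k := j) (l := i) (by simp [hji]) (by simp [hji]),
    moment_comm_right P i j j i, moment_comm_left P j i i j, moment_comm_left P j i j i,
    moment_comm_right P i j j i]
  ring

/-- Write a, b, m for the moments iiii, jjjj, ijij. Invariance under a reflection with the rational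
entries 3/5 and 4/5 gives 544a = 576m + 256b and 544b = 256a + 576m. Subtracting gives 800(a − b) =
0, and then 288a = 576m. -/
theorem moment_diag_eq [IsFiniteMeasure P]
    (hP : ∀ W : Unitaries ι, MeasurePreserving (evolve W) P P) {i j : ι} (hij : i ≠ j) :
    moment P i i i i = moment P j j j j ∧ moment P i i i i = 2 * moment P i j i j := by
  have h1 := integral_comp_evolve hP (planeReflection i j hij) _ (continuous_moment i i i i)
  have h2 := integral_comp_evolve hP (planeReflection i j hij) _ (continuous_moment j j j j)
  simp only [evolve_planeReflection_left] at h1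
  simp only [evolve_planeReflection_right] at h2
  have q1 := integral_plane_quartic hP hij (3 / 5) (-4 / 5)
  have q2 := integral_plane_quartic hP hij (-4 / 5) (-3 / 5)
  have e1 : moment P i i i i = _ := Eq.trans (h1.symm.trans ?_) q1
  have e2 : moment P j j j j = _ := Eq.trans (h2.symm.trans ?_) q2
  · push_cast at e1 e2
    constructor
    · linear_combination (625 / 800 : ℂ) * e1 - (625 / 800 : ℂ) * e2
    · linear_combination (625 / 288 - 256 / 288 * (625 / 800) : ℂ) * e1 +
        (256 / 288 * (625 / 800) : ℂ) * e2
  all_goals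
    refine integral_congr_ae (.of_forall fun x => ?_)
    push_cast
    ring_nf

/-- The normalization of the moments: integrate (∑ |x_i|²)² = 1. -/
theorem sum_moment_diag [IsProbabilityMeasure P] : ∑ i : ι, ∑ j : ι, moment P i j i j = 1 := by
  simp only [moment]
  rw [← Finset.sum_congr rfl fun i _ => integral_finsetSum _ fun j _ => integrable_moment P i j i j,
    ← integral_finsetSum _ fun i _ => integrable_finsetSum _ fun j _ => integrable_moment P i j i j]
  have h : ∀ x : PureState ι, ∑ i, ∑ j, (x : EuclideanSpace ℂ ι) i * (x : EuclideanSpace ℂ ι) j *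
      star ((x : EuclideanSpace ℂ ι) i) * star ((x : EuclideanSpace ℂ ι) j) = 1 := by
    intro x
    have h1 := sum_mul_star_self x
    calc _ = (∑ i, (x : EuclideanSpace ℂ ι) i * star ((x : EuclideanSpace ℂ ι) i)) *
        ∑ i, (x : EuclideanSpace ℂ ι) i * star ((x : EuclideanSpace ℂ ι) i) := by
          rw [Finset.sum_mul_sum]
          exact Finset.sum_congr rfl fun i _ => Finset.sum_congr rfl fun j _ => by ring
      _ = 1 := by rw [h1, one_mul]
  simp only [h]
  simp

/-- The fourth moments of a unitarily invariant probability measure on the unit sphere. -/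
theorem moment_eq [IsProbabilityMeasure P]
    (hP : ∀ W : Unitaries ι, MeasurePreserving (evolve W) P P) (i j k l : ι) :
    moment P i j k l = ((if i = k ∧ j = l then 1 else 0) + (if i = l ∧ j = k then 1 else 0)) /
      (Fintype.card ι * (Fintype.card ι + 1)) := by
  -- All surviving moments are expressed through one unknown, which the normalization then fixes,
  -- since ∑ (1 + δ_ab) = d² + d.
  have hoff : ∀ a b, 2 * moment P a b a b = (1 + if a = b then 1 else 0) * moment P i i i i := by
    intro a b
    have hai : moment P a a a a = moment P i i i i := by
      by_cases h : a = i
      · rw [h]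
      · exact (moment_diag_eq hP h).1
    by_cases hab : a = b
    · subst hab
      rw [hai, if_pos rfl]
      ring
    · rw [if_neg hab, ← hai, (moment_diag_eq hP hab).2]
      ring
  have hsum : (Fintype.card ι * (Fintype.card ι + 1) : ℂ) * moment P i i i i = 2 := by
    have h := congrArg (fun z : ℂ => 2 * z) (sum_moment_diag (P := P))
    simp only [Finset.mul_sum, hoff, ← Finset.sum_mul] at h
    simp only [Finset.sum_add_distrib, Finset.sum_const, Finset.card_univ, Finset.sum_ite_eq,
      Finset.mem_univ, if_true, nsmul_eq_mul, mul_one] at h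
    linear_combination h
  have hcard : (Fintype.card ι * (Fintype.card ι + 1) : ℂ) ≠ 0 := by
    intro h0
    rw [h0] at hsum
    norm_num at hsum
  rw [eq_div_iff hcard]
  by_cases h1 : i = k ∧ j = l
  · obtain ⟨rfl, rfl⟩ := h1
    have h := hoff i j
    by_cases hij : i = j
    · subst hij
      simp
      linear_combination hsum
    · simp [hij] at h ⊢
      linear_combination hsum / 2 + (Fintype.card ι * (Fintype.card ι + 1) : ℂ) / 2 * h
  · by_cases h2 : i = l ∧ j = k
    · obtain ⟨rfl, rfl⟩ := h2
      have hij : i ≠ j := fun h => h1 ⟨h, h.symm⟩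
      have h := hoff i j
      rw [moment_comm_right]
      simp [hij, hij.symm] at h ⊢
      linear_combination hsum / 2 + (Fintype.card ι * (Fintype.card ι + 1) : ℂ) / 2 * h
    · rw [moment_eq_zero hP h1 h2]
      simp [h1, h2]

/-- The average of `|⟨x, W x⟩|²` over the unit sphere. -/
theorem integral_norm_expectation_sq [IsProbabilityMeasure P]
    (hP : ∀ W : Unitaries ι, MeasurePreserving (evolve W) P P) (W : Unitaries ι) :
    ∫ x : PureState ι, ‖(inner ℂ (x : EuclideanSpace ℂ ι)
      (evolve W x : EuclideanSpace ℂ ι) : ℂ)‖ ^ 2 ∂P =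
    (‖(W : Matrix ι ι ℂ).trace‖ ^ 2 + Fintype.card ι) /
      (Fintype.card ι * (Fintype.card ι + 1)) := by
  set A : Matrix ι ι ℂ := (W : Matrix ι ι ℂ) with hA
  -- The two index pairings in `moment_eq` produce |tr W|² and tr WW†; unitarity makes the latter d.
  have hAA : ∑ i, ∑ j, A i j * star (A i j) = Fintype.card ι := by
    have h : (A * star A).trace = (1 : Matrix ι ι ℂ).trace := by
      rw [Matrix.mem_unitaryGroup_iff.mp W.2]
    rw [Matrix.trace_one] at h
    rw [← h, Matrix.trace]
    exact Finset.sum_congr rfl fun i _ => by simp [Matrix.mul_apply]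
  have expand : ∀ x : PureState ι, ((‖(inner ℂ (x : EuclideanSpace ℂ ι)
      (evolve W x : EuclideanSpace ℂ ι) : ℂ)‖ ^ 2 : ℝ) : ℂ) =
      ∑ i, ∑ j, ∑ k, ∑ l, A i j * star (A k l) * ((x : EuclideanSpace ℂ ι) j *
        (x : EuclideanSpace ℂ ι) k * star ((x : EuclideanSpace ℂ ι) i) *
        star ((x : EuclideanSpace ℂ ι) l)) := by
    intro x
    rw [← Complex.normSq_eq_norm_sq, ← Complex.mul_conj, ← Complex.star_def, inner_eq_sum]
    simp only [evolve_apply, ← hA]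
    rw [Finset.sum_mul]
    refine Finset.sum_congr rfl fun i _ => ?_
    rw [Finset.mul_sum, Finset.sum_mul]
    refine Finset.sum_congr rfl fun j _ => ?_
    rw [star_sum, Finset.mul_sum]
    refine Finset.sum_congr rfl fun k _ => ?_
    rw [Finset.mul_sum, star_sum, Finset.mul_sum]
    refine Finset.sum_congr rfl fun l _ => ?_
    simp only [star_mul', star_star]
    ring
  have I := fun i j k l => (integrable_moment P (ι := ι) j k i l).const_mul (A i j * star (A k l))
  have key : ((∫ x : PureState ι, ‖(inner ℂ (x : EuclideanSpace ℂ ι)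
      (evolve W x : EuclideanSpace ℂ ι) : ℂ)‖ ^ 2 ∂P : ℝ) : ℂ) =
      ∑ i, ∑ j, ∑ k, ∑ l, A i j * star (A k l) * moment P j k i l := by
    rw [← integral_complex_ofReal]
    simp only [expand]
    rw [integral_finsetSum _ fun i _ => integrable_finsetSum _ fun j _ =>
      integrable_finsetSum _ fun k _ => integrable_finsetSum _ fun l _ => I i j k l]
    refine Finset.sum_congr rfl fun i _ => ?_
    rw [integral_finsetSum _ fun j _ =>
      integrable_finsetSum _ fun k _ => integrable_finsetSum _ fun l _ => I i j k l]
    refine Finset.sum_congr rfl fun j _ => ?_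
    rw [integral_finsetSum _ fun k _ => integrable_finsetSum _ fun l _ => I i j k l]
    refine Finset.sum_congr rfl fun k _ => ?_
    rw [integral_finsetSum _ fun l _ => I i j k l]
    exact Finset.sum_congr rfl fun l _ => integral_const_mul _ _
  have hsum : ∑ i, ∑ j, ∑ k, ∑ l, A i j * star (A k l) *
      (((if j = i ∧ k = l then (1 : ℂ) else 0) + (if j = l ∧ k = i then 1 else 0))) =
      A.trace * star A.trace + Fintype.card ι := by
    simp only [mul_add, Finset.sum_add_distrib]
    congr 1
    · simp only [ite_and, mul_ite, mul_one, mul_zero, Finset.sum_ite_eq, Finset.mem_univ, if_true,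
        Finset.sum_ite_irrel, Finset.sum_const_zero, Finset.sum_ite_eq']
      simp [Matrix.trace, Finset.sum_mul_sum]
    · rw [← hAA]
      simp [ite_and]
  apply Complex.ofReal_injective
  rw [key]
  simp only [moment_eq hP, ← mul_div_assoc, ← Finset.sum_div]
  rw [hsum, Complex.star_def, Complex.mul_conj, Complex.normSq_eq_norm_sq]
  push_cast
  rfl

end Moments

/-! ### The risk as a function of |tr U†V|² -/

section RiskFormula

variable {ι : Type} [Fintype ι] [DecidableEq ι]

theorem evolve_mul (W W' : Unitaries ι) (x : PureState ι) :
    evolve (W * W') x = evolve W (evolve W' x) := by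
  ext1
  simp [evolve, Matrix.toLpLin_apply, Matrix.mulVec_mulVec]

theorem evolve_one (x : PureState ι) : evolve (1 : Unitaries ι) x = x := by
  ext1
  simp [evolve]

theorem inner_toEuclideanLin (W : Unitaries ι) (x y : EuclideanSpace ℂ ι) :
    inner ℂ (Matrix.toEuclideanLin (W : Matrix ι ι ℂ) x)
      (Matrix.toEuclideanLin (W : Matrix ι ι ℂ) y) = inner ℂ x y := by
  have hW : (W : Matrix ι ι ℂ).conjTranspose * (W : Matrix ι ι ℂ) = 1 :=
    Matrix.mem_unitaryGroup_iff'.mp W.2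
  rw [← LinearMap.adjoint_inner_right, ← Matrix.toEuclideanLin_conjTranspose_eq_adjoint]
  congr 1
  ext1
  simp [Matrix.toLpLin_apply, Matrix.mulVec_mulVec, hW]

theorem inner_evolve_evolve (U V : Unitaries ι) (x : PureState ι) :
    inner ℂ (evolve U x : EuclideanSpace ℂ ι) (evolve V x : EuclideanSpace ℂ ι) =
      inner ℂ (x : EuclideanSpace ℂ ι) (evolve (U⁻¹ * V) x : EuclideanSpace ℂ ι) := by
  have h : evolve V x = evolve U (evolve (U⁻¹ * V) x) := by
    rw [← evolve_mul, mul_inv_cancel_left]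
  rw [h]
  exact inner_toEuclideanLin U _ _

/-- A unitary matrix as a real-linear isometric automorphism of `ℂ^ι`. -/
noncomputable def evolveIsometry (W : Unitaries ι) :
    EuclideanSpace ℂ ι ≃ₗᵢ[ℝ] EuclideanSpace ℂ ι where
  toLinearEquiv := LinearEquiv.ofLinearMap
    ((Matrix.toEuclideanLin (W : Matrix ι ι ℂ)).restrictScalars ℝ)
    ((Matrix.toEuclideanLin ((W⁻¹ : Unitaries ι) : Matrix ι ι ℂ)).restrictScalars ℝ)
    (by
      ext1 x
      simp [Matrix.toLpLin_apply, Matrix.mulVec_mulVec])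
    (by
      ext1 x
      simp [Matrix.toLpLin_apply, Matrix.mulVec_mulVec])
  norm_map' x := by
    have h := inner_toEuclideanLin W x x
    rw [inner_self_eq_norm_sq_to_K, inner_self_eq_norm_sq_to_K] at h
    exact (pow_left_inj₀ (norm_nonneg _) (norm_nonneg _) two_ne_zero).mp (by exact_mod_cast h)

theorem continuous_evolve (W : Unitaries ι) : Continuous (evolve W) :=
  ((evolveIsometry W).continuous.comp continuous_subtype_val).subtype_mk _

open scoped Pointwise in
-- The surface measure of s is, up to a constant, the volume of the cone (0,1)·s. A unitary is a
-- real-linear isometry, so it carries cones to cones and preserves volume.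
theorem measurePreserving_evolve_toSphere (W : Unitaries ι) :
    MeasurePreserving (evolve W) (volume : Measure (EuclideanSpace ℂ ι)).toSphere
      (volume : Measure (EuclideanSpace ℂ ι)).toSphere := by
  refine ⟨(continuous_evolve W).measurable, Measure.ext fun s hs => ?_⟩
  rw [Measure.map_apply (continuous_evolve W).measurable hs,
    Measure.toSphere_apply' _ ((continuous_evolve W).measurable hs), Measure.toSphere_apply' _ hs]
  congr 1
  have h := (evolveIsometry W).measurePreserving.measure_preimage_emb
    (evolveIsometry W).toHomeomorph.measurableEmbedding
    (Set.Ioo (0 : ℝ) 1 • ((↑) '' s : Set (EuclideanSpace ℂ ι)))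
  rw [← h]
  congr 1
  ext x
  simp only [Set.mem_smul, Set.mem_image, Set.mem_preimage]
  constructor
  · rintro ⟨r, hr, _, ⟨y, hy, rfl⟩, rfl⟩
    exact ⟨r, hr, _, ⟨_, hy, rfl⟩, ((evolveIsometry W).map_smul r _).symm⟩
  · rintro ⟨r, hr, _, ⟨y, hy, rfl⟩, hx⟩
    have hyW : evolve W (evolve W⁻¹ y) = y := by rw [← evolve_mul, mul_inv_cancel, evolve_one]
    refine ⟨r, hr, _, ⟨evolve W⁻¹ y, ?_, rfl⟩, (evolveIsometry W).injective ?_⟩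
    · rwa [hyW]
    · rw [map_smul, ← hx]
      exact congrArg (fun z : PureState ι => r • (z : EuclideanSpace ℂ ι)) hyW

theorem risk_eq [Nonempty ι] (U V : Unitaries ι) :
    risk U V = 1 - (‖(((U⁻¹ * V : Unitaries ι)) : Matrix ι ι ℂ).trace‖ ^ 2 + Fintype.card ι) /
      (Fintype.card ι * (Fintype.card ι + 1)) := by
  unfold risk
  simp only [traceDist_density_sq, inner_evolve_evolve]
  set μ : Measure (PureState ι) := (volume : Measure (EuclideanSpace ℂ ι)).toSphere with hμ
  have hμ0 : NeZero μ := ⟨Measure.toSphere_ne_zero _⟩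
  rw [average]
  -- The average in `risk` is the integral against this invariant probability measure, to which the
  -- moment formula applies.
  set P := (μ Set.univ)⁻¹ • μ with hPdef
  have hPprob : IsProbabilityMeasure P := isProbabilityMeasureSMul
  have hP : ∀ W : Unitaries ι, MeasurePreserving (evolve W) P P := fun W =>
    (measurePreserving_evolve_toSphere W).smul_measure _
  rw [integral_sub (integrable_const _), integral_norm_expectation_sq hP]
  · simp
  · exact integrable_of_continuous P ((continuous_subtype_val.inner
      (continuous_subtype_val.comp (continuous_evolve _))).norm.pow 2)

end RiskFormula

/-! ### Finite averages of squared traces over unitaries fixing a subspace -/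

section Averaging

/-- The sign `±1` encoded by a Boolean. -/
def boolSign (b : Bool) : ℂ := if b then 1 else -1

theorem boolSign_mul_star (b : Bool) : boolSign b * star (boolSign b) = 1 := by
  cases b <;> simp [boolSign]

theorem star_boolSign (b : Bool) : star (boolSign b) = boolSign b := by
  cases b <;> simp [boolSign]

/-- Random signs are orthogonal to each other and to constants. -/
theorem sum_sign_norm_sq (m : ℕ) (a : ℂ) (c : Fin m → ℂ) :
    ∑ s : Fin m → Bool, ‖a + ∑ i, boolSign (s i) * c i‖ ^ 2 =
      2 ^ m * (‖a‖ ^ 2 + ∑ i, ‖c i‖ ^ 2) := by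
  induction m generalizing a with
  | zero => simp
  | succ m ih =>
    rw [← (Fin.consEquiv fun _ : Fin (m + 1) => Bool).sum_comp, Fintype.sum_prod_type]
    simp only [Fin.consEquiv_apply, Fin.sum_univ_succ, Fin.cons_zero, Fin.cons_succ, ← add_assoc,
      ih, Fintype.sum_bool]
    -- The induction hypothesis is used at a + c₀ and a − c₀; the parallelogram law recombines the
    -- two.
    have h := parallelogram_law_with_norm ℝ a (c 0)
    simp only [boolSign, if_true, Bool.false_eq_true, if_false, one_mul, neg_mul, ← sub_eq_add_neg]
    rw [pow_succ]
    linear_combination (2 : ℝ) ^ m * h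

variable {κ : Type} [Fintype κ] [DecidableEq κ]

theorem sum_norm_sq_column (N : Unitaries κ) (i : κ) :
    ∑ j, ‖(N : Matrix κ κ ℂ) j i‖ ^ 2 = 1 := by
  have h := congrFun (congrFun (Matrix.mem_unitaryGroup_iff'.mp N.2) i) i
  simp only [Matrix.mul_apply, Matrix.star_apply, Matrix.one_apply_eq, Complex.star_def,
    Complex.conj_mul'] at h
  exact_mod_cast h

theorem norm_sum_diag_le {α : Type} [Fintype α] (N : Unitaries κ) (f : α → κ) :
    ‖∑ i, (N : Matrix κ κ ℂ) (f i) (f i)‖ ≤ Fintype.card α := by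
  refine (norm_sum_le _ _).trans ?_
  refine (Finset.sum_le_sum fun i _ => entry_norm_bound_of_unitary N.2 (f i) (f i)).trans ?_
  simp

/-- The signed cyclic shift `e_i ↦ ± e_{k + i}`. -/
def signedShift {m : ℕ} [NeZero m] (s : Fin m → Bool) (k : Fin m) : Matrix (Fin m) (Fin m) ℂ :=
  Matrix.of fun j i => if j = k + i then boolSign (s i) else 0

theorem signedShift_conjTranspose_mul {m : ℕ} [NeZero m] (s : Fin m → Bool) (k : Fin m) :
    (signedShift s k).conjTranspose * signedShift s k = 1 := by
  ext i j
  simp only [Matrix.mul_apply, Matrix.conjTranspose_apply, signedShift, Matrix.of_apply]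
  rw [Finset.sum_eq_single (k + i) (by simp +contextual) (by simp)]
  by_cases h : i = j
  · subst h
    rw [if_pos rfl, mul_comm, boolSign_mul_star, Matrix.one_apply_eq]
  · simp [h]

/-- This family is a finite substitute for the Haar average over the second block. The sign average
removes the cross terms and leaves |a|² plus the squared moduli of the entries at (k + i, i), where
a is the trace of the first block. As k varies, these positions cover the second block once; its m
columns have norm at most 1, so the mean over the m shifts is at most 1. -/
theorem sum_norm_trace_block_le {α : Type} [Fintype α] [DecidableEq α] {m : ℕ} [NeZero m]
    (N : Unitaries (α ⊕ Fin m)) :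
    ∑ p : Fin m × (Fin m → Bool), ‖((Matrix.fromBlocks (1 : Matrix α α ℂ) 0 0
      (signedShift p.2 p.1)).conjTranspose * (N : Matrix (α ⊕ Fin m) (α ⊕ Fin m) ℂ)).trace‖ ^ 2 ≤
      Fintype.card (Fin m × (Fin m → Bool)) * ((Fintype.card α : ℝ) ^ 2 + 1) := by
  set A : Matrix (α ⊕ Fin m) (α ⊕ Fin m) ℂ := (N : Matrix (α ⊕ Fin m) (α ⊕ Fin m) ℂ) with hA
  have htr : ∀ p : Fin m × (Fin m → Bool), ((Matrix.fromBlocks (1 : Matrix α α ℂ) 0 0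
      (signedShift p.2 p.1)).conjTranspose * A).trace =
      ∑ i, A (.inl i) (.inl i) + ∑ i, boolSign (p.2 i) * A (.inr (p.1 + i)) (.inr i) := by
    intro p
    simp only [Matrix.trace, Matrix.diag_apply, Fintype.sum_sum_type, Matrix.mul_apply,
      Matrix.conjTranspose_apply, Matrix.fromBlocks_apply₁₁, Matrix.fromBlocks_apply₁₂,
      Matrix.fromBlocks_apply₂₁, Matrix.fromBlocks_apply₂₂, Matrix.zero_apply, star_zero, zero_mul,
      Finset.sum_const_zero, add_zero, zero_add, signedShift, Matrix.of_apply]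
    congr 1
    · exact Finset.sum_congr rfl fun i _ => by
        rw [Finset.sum_eq_single i] <;> simp +contextual
    · exact Finset.sum_congr rfl fun i _ => by
        rw [Finset.sum_eq_single (p.1 + i)] <;> simp +contextual [star_boolSign, - Complex.star_def, - RCLike.star_def]
  have hle : ∑ k : Fin m, ∑ i : Fin m, ‖A (.inr (k + i)) (.inr i)‖ ^ 2 ≤ m := by
    rw [Finset.sum_comm]
    have : ∀ i : Fin m, ∑ k : Fin m, ‖A (.inr (k + i)) (.inr i)‖ ^ 2 ≤ 1 := by
      intro i
      refine (Equiv.sum_comp (Equiv.addRight i) fun j => ‖A (.inr j) (.inr i)‖ ^ 2).le.trans ?_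
      have h := sum_norm_sq_column N (.inr i)
      rw [Fintype.sum_sum_type] at h
      rw [← h]
      exact le_add_of_nonneg_left (Finset.sum_nonneg fun _ _ => sq_nonneg _)
    exact (Finset.sum_le_sum fun i _ => this i).trans (by simp)
  have ha : ‖∑ i, A (.inl i) (.inl i)‖ ^ 2 ≤ (Fintype.card α : ℝ) ^ 2 :=
    pow_le_pow_left₀ (norm_nonneg _) (norm_sum_diag_le N Sum.inl) 2
  simp only [htr]
  rw [Fintype.sum_prod_type]
  simp only [sum_sign_norm_sq]
  rw [← Finset.mul_sum, Finset.sum_add_distrib]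
  simp only [Finset.sum_const, Finset.card_univ, Fintype.card_fin, nsmul_eq_mul,
    Fintype.card_prod, Fintype.card_pi, Finset.prod_const, Fintype.card_bool]
  push_cast
  have h1 : (m : ℝ) * ‖∑ i, A (.inl i) (.inl i)‖ ^ 2 ≤ m * (Fintype.card α : ℝ) ^ 2 := by gcongr
  have h2 : (0 : ℝ) ≤ 2 ^ m := by positivity
  calc _ ≤ (2 : ℝ) ^ m * (m * (Fintype.card α : ℝ) ^ 2 + m) := by gcongr
    _ = _ := by ring

variable {ι : Type} [Fintype ι] [DecidableEq ι]

/-- There are finitely many unitaries that fix the subspace `K` pointwise and whose inverses have,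
composed with any unitary, an average squared trace of at most `(dim K) ^ 2 + 1`. -/
theorem exists_unitaries_fixing_submodule (K : Submodule ℂ (EuclideanSpace ℂ ι)) :
    ∃ (T : Type) (_ : Fintype T) (_ : Nonempty T) (Y : T → Unitaries ι),
      (∀ p, ∀ v ∈ K, Matrix.toEuclideanLin (Y p : Matrix ι ι ℂ) v = v) ∧
      ∀ W : Unitaries ι, ∑ p, ‖(((Y p)⁻¹ * W : Unitaries ι) : Matrix ι ι ℂ).trace‖ ^ 2 ≤
        Fintype.card T * ((Module.finrank ℂ K : ℝ) ^ 2 + 1) := by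
  have hdim := K.finrank_add_finrank_orthogonal
  rw [finrank_euclideanSpace] at hdim
  rcases Nat.eq_zero_or_pos (Module.finrank ℂ Kᗮ) with h0 | hpos
  -- If K is the whole space, the identity alone suffices, since |tr W|² ≤ d². The cyclic shift
  -- requires m ≠ 0.
  · refine ⟨Unit, inferInstance, inferInstance, fun _ => 1, fun _ v _ => by simp, fun W => ?_⟩
    have h := pow_le_pow_left₀ (norm_nonneg _) (norm_sum_diag_le W id) 2
    rw [h0, add_zero] at hdim
    rw [← hdim] at h
    simp only [inv_one, one_mul, Finset.univ_unique, Finset.sum_singleton, Fintype.card_unit,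
      Nat.cast_one]
    exact h.trans (by simp)
  · set m := Module.finrank ℂ Kᗮ with hm
    have : NeZero m := ⟨hpos.ne'⟩
    let u := stdOrthonormalBasis ℂ K
    let w := stdOrthonormalBasis ℂ Kᗮ
    let v : Fin (Module.finrank ℂ K) ⊕ Fin m → EuclideanSpace ℂ ι :=
      Sum.elim (fun i => (u i : EuclideanSpace ℂ ι)) fun i => (w i : EuclideanSpace ℂ ι)
    have huw : ∀ i j, inner ℂ (u i : EuclideanSpace ℂ ι) (w j : EuclideanSpace ℂ ι) = 0 :=
      fun i j => (w j).2 _ (u i).2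
    have hv : Orthonormal ℂ v := by
      rw [orthonormal_iff_ite]
      have hu := orthonormal_iff_ite.mp u.orthonormal
      have hw := orthonormal_iff_ite.mp w.orthonormal
      rintro (i | i) (j | j)
      · simpa [v] using hu i j
      · simpa [v] using huw i j
      · simpa [v] using inner_eq_zero_symm.mp (huw j i)
      · simpa [v] using hw i j
    -- B is the unitary change of basis to one adapted to K and its orthogonal complement;
    -- conjugation by B transports the block unitaries to the original space.
    let B : Matrix ι (Fin (Module.finrank ℂ K) ⊕ Fin m) ℂ := Matrix.of fun i k => v k i
    have hBB : B.conjTranspose * B = 1 := by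
      ext k l
      have h := orthonormal_iff_ite.mp hv k l
      rw [PiLp.inner_apply] at h
      rw [Matrix.one_apply, ← h, Matrix.mul_apply]
      simp [B, mul_comm]
    have hcard : Fintype.card ι = Fintype.card (Fin (Module.finrank ℂ K) ⊕ Fin m) := by
      simp [← hdim]
    have hBB' : B * B.conjTranspose = 1 :=
      (Matrix.mul_eq_one_comm_of_card_eq _ _ _ hcard).mpr hBB
    let M : Fin m × (Fin m → Bool) → Matrix (Fin (Module.finrank ℂ K) ⊕ Fin m)
      (Fin (Module.finrank ℂ K) ⊕ Fin m) ℂ := fun p => Matrix.fromBlocks 1 0 0 (signedShift p.2 p.1)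
    have hMM : ∀ p, (M p).conjTranspose * M p = 1 := fun p => by
      simp [M, Matrix.fromBlocks_conjTranspose, Matrix.fromBlocks_multiply,
        signedShift_conjTranspose_mul]
    let Y : Fin m × (Fin m → Bool) → Unitaries ι := fun p =>
      ⟨B * M p * B.conjTranspose, by
        rw [Matrix.mem_unitaryGroup_iff', Matrix.star_eq_conjTranspose]
        simp only [Matrix.conjTranspose_mul, Matrix.conjTranspose_conjTranspose]
        calc _ = B * ((M p).conjTranspose * (B.conjTranspose * B) * M p) * B.conjTranspose := by
              simp only [Matrix.mul_assoc]
          _ = 1 := by rw [hBB, Matrix.mul_one, hMM, Matrix.mul_one, hBB']⟩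
    refine ⟨Fin m × (Fin m → Bool), inferInstance, inferInstance, Y, fun p x hx => ?_, fun W => ?_⟩
    · have hzero : ∀ i, (B.conjTranspose.mulVec x.ofLp) (.inr i) = 0 := by
        intro i
        have h : inner ℂ (w i : EuclideanSpace ℂ ι) x = 0 :=
          inner_eq_zero_symm.mp ((w i).2 x hx)
        rw [PiLp.inner_apply] at h
        rw [← h]
        simp [Matrix.mulVec, dotProduct, B, v, mul_comm]
      have hfix : (M p).mulVec (B.conjTranspose.mulVec x.ofLp) = B.conjTranspose.mulVec x.ofLp := by
        ext (i | i)
        · simp [M, Matrix.mulVec, dotProduct, Matrix.one_apply]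
        · rw [hzero]
          simp only [Matrix.mulVec, dotProduct, Fintype.sum_sum_type] at hzero ⊢
          simp [M, -Matrix.conjTranspose_apply, hzero]
      ext1
      simp only [Matrix.toLpLin_apply, Y]
      rw [← Matrix.mulVec_mulVec, ← Matrix.mulVec_mulVec, hfix, Matrix.mulVec_mulVec, hBB',
        Matrix.one_mulVec]
    · let N : Unitaries (Fin (Module.finrank ℂ K) ⊕ Fin m) :=
        ⟨B.conjTranspose * (W : Matrix ι ι ℂ) * B, by
          rw [Matrix.mem_unitaryGroup_iff', Matrix.star_eq_conjTranspose]
          simp only [Matrix.conjTranspose_mul, Matrix.conjTranspose_conjTranspose]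
          have hW : (W : Matrix ι ι ℂ).conjTranspose * (W : Matrix ι ι ℂ) = 1 :=
            Matrix.mem_unitaryGroup_iff'.mp W.2
          calc _ = B.conjTranspose * ((W : Matrix ι ι ℂ).conjTranspose * (B * B.conjTranspose) *
                (W : Matrix ι ι ℂ)) * B := by simp only [Matrix.mul_assoc]
            _ = 1 := by rw [hBB', Matrix.mul_one, hW, Matrix.mul_one, hBB]⟩
      have h := sum_norm_trace_block_le N
      rw [Fintype.card_fin] at h
      refine le_of_eq_of_le (Finset.sum_congr rfl fun p _ => ?_) h
      congr 2
      change ((B * M p * B.conjTranspose).conjTranspose * (W : Matrix ι ι ℂ)).trace =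
        ((M p).conjTranspose * (B.conjTranspose * (W : Matrix ι ι ℂ) * B)).trace
      simp only [Matrix.conjTranspose_mul, Matrix.conjTranspose_conjTranspose, Matrix.mul_assoc]
      -- Cyclicity of the trace moves B from one end to the other, turning W into B†WB.
      rw [Matrix.trace_mul_comm]
      simp only [Matrix.mul_assoc]

end Averaging

/-! ### Invariance of the training set and the averaged lower bound -/

section NoFreeLunch

variable {ι κ : Type} [Fintype ι] [DecidableEq ι] [Fintype κ] [DecidableEq κ] {t : ℕ}

instance instIsProbabilityMeasureHaarUnitary : IsProbabilityMeasure (haarUnitary ι) :=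
  ⟨by simpa [haarUnitary] using
    Measure.haarMeasure_self (K₀ := (⊤ : TopologicalSpace.PositiveCompacts (Unitaries ι)))⟩

instance instIsHaarMeasureHaarUnitary : (haarUnitary ι).IsHaarMeasure :=
  Measure.isHaarMeasure_haarMeasure _

/-- A right translate of Haar measure is again a left-invariant probability measure, so uniqueness
applies. Right invariance is the form needed, because Y acts on the input before U. -/
instance instIsMulRightInvariantHaarUnitary : (haarUnitary ι).IsMulRightInvariant := ⟨fun g => by
  have h1 : IsProbabilityMeasure ((haarUnitary ι).map (· * g)) :=
    Measure.isProbabilityMeasure_map (measurable_mul_const g).aemeasurable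
  exact Measure.isHaarMeasure_eq_of_isProbabilityMeasure _ _⟩

/-- This identifies the Borel σ-algebra of a product of unitary groups with the product σ-algebra,
so that continuity of the risk yields joint measurability. -/
instance instSecondCountableTopologyUnitaries : SecondCountableTopology (Unitaries ι) := by
  have : SecondCountableTopology (Matrix ι ι ℂ) :=
    inferInstanceAs (SecondCountableTopology (ι → ι → ℂ))
  exact TopologicalSpace.Subtype.secondCountableTopology _

theorem evolve_tensorId_apply (W : Unitaries ι) (ψ : PureState (ι × κ)) (i : ι) (a : κ) :
    (evolve (tensorId κ W) ψ : EuclideanSpace ℂ (ι × κ)) (i, a) =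
      ∑ j, (W : Matrix ι ι ℂ) i j * (ψ : EuclideanSpace ℂ (ι × κ)) (j, a) := by
  simp [evolve_apply, tensorId, Fintype.sum_prod_type, Matrix.kroneckerMap_apply, Matrix.one_apply]

theorem continuous_trainingSet :
    Continuous fun p : Unitaries ι × (Fin t → PureState (ι × κ)) => trainingSet p.1 p.2 := by
  refine continuous_pi fun j => ((continuous_apply j).comp continuous_snd).prodMk ?_
  refine Continuous.subtype_mk ?_ _
  refine (PiLp.continuous_toLp 2 _).comp (continuous_pi fun ia => ?_)
  refine continuous_finsetSum _ fun jb _ => Continuous.mul ?_ ?_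
  · refine Continuous.mul ?_ continuous_const
    exact (continuous_subtype_val.comp continuous_fst).matrix_elem _ _
  · exact (continuous_coord jb).comp ((continuous_apply j).comp continuous_snd)

theorem continuous_risk [Nonempty ι] :
    Continuous fun p : Unitaries ι × Unitaries ι => risk p.1 p.2 := by
  simp only [risk_eq]
  refine continuous_const.sub (Continuous.div_const ?_ _)
  exact ((((continuous_subtype_val.comp
    (continuous_fst.inv.mul continuous_snd)).matrix_trace).norm.pow 2).add continuous_const)

theorem measurable_trainingSet :
    Measurable fun p : Unitaries ι × (Fin t → PureState (ι × κ)) => trainingSet p.1 p.2 := by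
  refine measurable_pi_lambda _ fun j => ?_
  have h := (continuous_apply j).comp (continuous_trainingSet (ι := ι) (κ := κ) (t := t))
  exact h.fst.measurable.prodMk h.snd.measurable

theorem measurable_risk [Nonempty ι] {α : Type*} [MeasurableSpace α] {f g : α → Unitaries ι}
    (hf : Measurable f) (hg : Measurable g) : Measurable fun a => risk (f a) (g a) := by
  have h := (continuous_risk (ι := ι)).measurable.comp (hf.prodMk hg)
  dsimp only [Function.comp_def] at h
  exact h

theorem measurable_risk_trainingSet [Nonempty ι] {V : TrainingSet ι κ t → Unitaries ι}
    (hV : Measurable V) :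
    Measurable fun p : Unitaries ι × (Fin t → PureState (ι × κ)) =>
      risk p.1 (V (trainingSet p.1 p.2)) :=
  measurable_risk (f := Prod.fst) (g := fun p => V (trainingSet p.1 p.2)) measurable_fst
    (hV.comp measurable_trainingSet)

/-- The subspace spanned by the Schmidt vectors on the first factor determines the action. -/
theorem evolve_tensorId_eq_self {ψ : PureState (ι × κ)} {r : ℕ} {c : Fin r → ℝ}
    {ξ : Fin r → EuclideanSpace ℂ ι} {ζ : Fin r → EuclideanSpace ℂ κ}
    (hψ : ∀ i a, (ψ : EuclideanSpace ℂ (ι × κ)) (i, a) =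
      ∑ k, (Real.sqrt (c k) : ℂ) * (ξ k i * ζ k a))
    {Y : Unitaries ι} (hY : ∀ k, Matrix.toEuclideanLin (Y : Matrix ι ι ℂ) (ξ k) = ξ k) :
    evolve (tensorId κ Y) ψ = ψ := by
  ext ⟨i, a⟩
  rw [evolve_tensorId_apply, hψ]
  simp only [hψ, Finset.mul_sum]
  rw [Finset.sum_comm]
  refine Finset.sum_congr rfl fun k _ => ?_
  have h : ∑ j, (Y : Matrix ι ι ℂ) i j * ξ k j = ξ k i := by
    conv_rhs => rw [← hY k]
    simp [Matrix.toLpLin_apply, Matrix.mulVec, dotProduct]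
  rw [← h, Finset.sum_mul, Finset.mul_sum]
  exact Finset.sum_congr rfl fun j _ => by ring

theorem tensorId_mul (U W : Unitaries ι) : tensorId κ (U * W) = tensorId κ U * tensorId κ W := by
  ext1
  simp [tensorId, ← Matrix.mul_kronecker_mul]

theorem trainingSet_mul_eq {U Y : Unitaries ι} {ψ : Fin t → PureState (ι × κ)}
    (hY : ∀ j, evolve (tensorId κ Y) (ψ j) = ψ j) : trainingSet (U * Y) ψ = trainingSet U ψ := by
  funext j
  rw [trainingSet, trainingSet, tensorId_mul, evolve_mul, hY]

theorem abs_risk_le [Nonempty ι] (U V : Unitaries ι) : ‖risk U V‖ ≤ 1 := by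
  have hd : (1 : ℝ) ≤ Fintype.card ι := by exact_mod_cast Fintype.card_pos
  have htr := pow_le_pow_left₀ (norm_nonneg _) (norm_sum_diag_le (U⁻¹ * V) id) 2
  rw [risk_eq, Real.norm_eq_abs, abs_le]
  have h1 : (‖(((U⁻¹ * V : Unitaries ι)) : Matrix ι ι ℂ).trace‖ ^ 2 + Fintype.card ι) /
      (Fintype.card ι * (Fintype.card ι + 1) : ℝ) ≤ 1 := by
    rw [div_le_one (by positivity)]
    have : ‖(((U⁻¹ * V : Unitaries ι)) : Matrix ι ι ℂ).trace‖ ^ 2 ≤ (Fintype.card ι : ℝ) ^ 2 := htr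
    linarith
  have h2 : 0 ≤ (‖(((U⁻¹ * V : Unitaries ι)) : Matrix ι ι ℂ).trace‖ ^ 2 + Fintype.card ι) /
      (Fintype.card ι * (Fintype.card ι + 1) : ℝ) := by positivity
  constructor <;> linarith

/-- For training inputs of fixed Schmidt ranks, the risk averaged over the target is bounded
below, whatever the training procedure. Replacing the target `U` by `U * Y`, where `Y` fixes the
Schmidt vectors, does not change the training set, and averaging over such `Y` bounds the overlap
of the target with any hypothesis; perfect training is not needed for this. -/
theorem le_integral_risk [Nonempty ι] {ψ : Fin t → PureState (ι × κ)} {r : Fin t → ℕ}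
    (hr : ∀ j, HasSchmidtRank (ψ j) (r j)) {V : TrainingSet ι κ t → Unitaries ι}
    (hV : Measurable V) :
    1 - ((∑ j, (r j : ℝ)) ^ 2 + Fintype.card ι + 1) /
        ((Fintype.card ι : ℝ) * (Fintype.card ι + 1)) ≤
      ∫ U, risk U (V (trainingSet U ψ)) ∂haarUnitary ι := by
  choose c ξ ζ hc hc1 hξ hζ hψ using hr
  -- The Schmidt vectors of different samples need not be independent, so the sum of the ranks only
  -- bounds the dimension from above.
  set K : Submodule ℂ (EuclideanSpace ℂ ι) :=
    Submodule.span ℂ (Set.range fun p : Σ j, Fin (r j) => ξ p.1 p.2) with hK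
  have hdim : (Module.finrank ℂ K : ℝ) ≤ ∑ j, (r j : ℝ) := by
    have h := finrank_range_le_card (R := ℂ) fun p : Σ j, Fin (r j) => ξ p.1 p.2
    rw [Fintype.card_sigma] at h
    simp only [Fintype.card_fin] at h
    exact_mod_cast h
  obtain ⟨T, _, _, Y, hYK, hYtr⟩ := exists_unitaries_fixing_submodule K
  have hS : ∀ p U, trainingSet (U * Y p) ψ = trainingSet U ψ := fun p U =>
    trainingSet_mul_eq fun j => evolve_tensorId_eq_self (hψ j) fun k =>
      hYK p _ (Submodule.subset_span ⟨⟨j, k⟩, rfl⟩)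
  have hmeas : Measurable fun U : Unitaries ι => risk U (V (trainingSet U ψ)) :=
    measurable_risk (f := id) (g := fun U => V (trainingSet U ψ)) measurable_id
      (hV.comp (measurable_trainingSet.comp measurable_prodMk_right))
  have hint : Integrable (fun U : Unitaries ι => risk U (V (trainingSet U ψ))) (haarUnitary ι) :=
    Integrable.of_bound hmeas.aestronglyMeasurable 1 (.of_forall fun U => abs_risk_le _ _)
  -- The target is shifted while the hypothesis stays put: right invariance moves U to U Y p
  -- everywhere, and `hS` undoes the shift inside the training set.
  have hshift : ∀ p, ∫ U, risk (U * Y p) (V (trainingSet U ψ)) ∂haarUnitary ι =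
      ∫ U, risk U (V (trainingSet U ψ)) ∂haarUnitary ι := by
    intro p
    rw [← integral_mul_right_eq_self (fun U => risk U (V (trainingSet U ψ))) (Y p)]
    simp only [hS]
  have hshiftint : ∀ p, Integrable (fun U : Unitaries ι => risk (U * Y p) (V (trainingSet U ψ)))
      (haarUnitary ι) := by
    intro p
    have h := hint.comp_mul_right (Y p)
    simpa only [hS] using h
  have hT : (0 : ℝ) < Fintype.card T := by exact_mod_cast Fintype.card_pos
  have hd : (0 : ℝ) < (Fintype.card ι : ℝ) * (Fintype.card ι + 1) := by
    have : 0 < Fintype.card ι := Fintype.card_pos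
    positivity
  have hpoint : ∀ U, Fintype.card T * (1 - ((∑ j, (r j : ℝ)) ^ 2 + Fintype.card ι + 1) /
        ((Fintype.card ι : ℝ) * (Fintype.card ι + 1))) ≤
      ∑ p, risk (U * Y p) (V (trainingSet U ψ)) := by
    intro U
    -- The relevant overlap is (U Y p)⁻¹V = (Y p)⁻¹(U⁻¹V), with the same U⁻¹V for all p.
    have h := hYtr (U⁻¹ * V (trainingSet U ψ))
    have hsq : (Module.finrank ℂ K : ℝ) ^ 2 ≤ (∑ j, (r j : ℝ)) ^ 2 :=
      pow_le_pow_left₀ (Nat.cast_nonneg _) hdim 2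
    simp only [risk_eq, mul_inv_rev, mul_assoc]
    rw [Finset.sum_sub_distrib, ← Finset.sum_div, Finset.sum_add_distrib]
    simp only [Finset.sum_const, Finset.card_univ, nsmul_eq_mul, mul_one]
    rw [mul_sub, mul_one, ← mul_div_assoc]
    gcongr
    have h' := h.trans (mul_le_mul_of_nonneg_left (add_le_add_left hsq 1) hT.le)
    linarith
  have hfinal : Fintype.card T * (1 - ((∑ j, (r j : ℝ)) ^ 2 + Fintype.card ι + 1) /
        ((Fintype.card ι : ℝ) * (Fintype.card ι + 1))) ≤
      Fintype.card T * ∫ U, risk U (V (trainingSet U ψ)) ∂haarUnitary ι := by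
    calc _ = ∫ _ : Unitaries ι, Fintype.card T * (1 - ((∑ j, (r j : ℝ)) ^ 2 + Fintype.card ι + 1) /
        ((Fintype.card ι : ℝ) * (Fintype.card ι + 1))) ∂haarUnitary ι := by simp
      _ ≤ ∫ U, ∑ p, risk (U * Y p) (V (trainingSet U ψ)) ∂haarUnitary ι :=
        integral_mono (integrable_const _) (integrable_finsetSum _ fun p _ => hshiftint p) hpoint
      _ = _ := by
        rw [integral_finsetSum _ fun p _ => hshiftint p]
        simp [hshift]
  exact le_of_mul_le_mul_left hfinal hT

end NoFreeLunch

end QNFL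

theorem mainTheorem1 (d dR t : ℕ) (hd : 0 < d) (ht : 0 < t) (rbar : ℝ)
    -- the distribution of the tuple of training inputs; average Schmidt rank `rbar`
    (ν : Measure (Fin t → QNFL.PureState (Fin d × Fin dR))) [IsProbabilityMeasure ν]
    (hrank : ∀ᵐ ψ ∂ν, ∃ r : Fin t → ℕ,
      (∀ j, QNFL.HasSchmidtRank (ψ j) (r j)) ∧ rbar = (1 / (t : ℝ)) * ∑ j, (r j : ℝ))
    -- the training procedure `S ↦ V_S`, with perfect training
    (V : QNFL.TrainingSet (Fin d) (Fin dR) t → QNFL.Unitaries (Fin d)) (hV : Measurable V)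
    (hperfect : ∀ᵐ U ∂(QNFL.haarUnitary (Fin d)), ∀ᵐ ψ ∂ν,
      QNFL.loss (QNFL.trainingSet U ψ) (V (QNFL.trainingSet U ψ)) = 0) :
    1 - ((rbar * t) ^ 2 + d + 1) / ((d : ℝ) * (d + 1)) ≤
      ∫ U, ∫ ψ, QNFL.risk U (V (QNFL.trainingSet U ψ)) ∂ν ∂(QNFL.haarUnitary (Fin d)) := by
  have : Nonempty (Fin d) := ⟨⟨0, hd⟩⟩
  have hint : Integrable (fun p : QNFL.Unitaries (Fin d) ×
      (Fin t → QNFL.PureState (Fin d × Fin dR)) => QNFL.risk p.1 (V (QNFL.trainingSet p.1 p.2)))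
      ((QNFL.haarUnitary (Fin d)).prod ν) :=
    Integrable.of_bound (QNFL.measurable_risk_trainingSet hV).aestronglyMeasurable 1 (.of_forall fun p => QNFL.abs_risk_le _ _)
  -- With the inputs on the outside, the bound for a fixed tuple applies to the inner integral over
  -- U, almost surely in ψ.
  rw [integral_integral_swap hint]
  have hconst : ∫ _, (1 - ((rbar * t) ^ 2 + d + 1) / ((d : ℝ) * (d + 1))) ∂ν =
      1 - ((rbar * t) ^ 2 + d + 1) / ((d : ℝ) * (d + 1)) := by simp
  rw [← hconst]
  refine integral_mono_ae (integrable_const _) hint.integral_prod_right ?_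
  filter_upwards [hrank] with ψ ⟨r, hr, hrbar⟩
  have h := QNFL.le_integral_risk hr hV
  have ht' : (t : ℝ) ≠ 0 := by exact_mod_cast ht.ne'
  have hsum : rbar * t = ∑ j, (r j : ℝ) := by
    rw [hrbar]
    field_simp
  rw [hsum]
  simpa only [Fintype.card_fin] using h
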